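/- Corollary C. For $h\ge 1$ let $Sp(2h;\mathbb{Z}_2)$ be the group of $2h\times 2h$ matrices over $\mathbb{Z}_2$ preserving the standard symplectic form on $\mathbb{Z}_2^{2h}$, and let $Sp(2h;\mathbb{Z}_2)\ltimes\mathbb{Z}_2^{2h+1}$ be the semidirect product in which $A\in Sp(2h;\mathbb{Z}_2)$ acts on $\mathbb{Z}_2^{2h+1}=\mathbb{Z}_2^{2h}\times\mathbb{Z}_2$ by $$A\cdot(v,t)=\bigl(Av,\;t+q(Av)+q(v)\bigr),\qquad q(x_1,\dots,x_h,y_1,\dots,y_h)=\sum_{i=1}^h x_iy_i .$$ (This is the group that arises, up to isomorphism, as the group of automorphisms of $H_1(N_{2h+2};\mathbb{Z}_2)$ preserving the mod $2$ intersection pairing, where $N_g$ denotes the closed connected nonorientable surface of genus $g$.) Then: 1. for every odd $g\ge 19$, the group $Sp(g-1;\mathbb{Z}_2)$ is generated by two elements; 2. for every odd $g\ge 27$, the group $Sp(g-1;\mathbb{Z}_2)$ is generated by three involutions, i.e. three elements of order exactly $2$; 3. for every even $g\ge 20$, the group $Sp(g-2;\mathbb{Z}_2)\ltimes\mathbb{Z}_2^{g-1}$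 is generated by two elements; 4. for every even $g\ge 26$, the group $Sp(g-2;\mathbb{Z}_2)\ltimes\mathbb{Z}_2^{g-1}$ is generated by three involutions. -/

import Mathlib

open Matrix

/-- The group `G` is generated by two elements. -/
def GeneratedByTwoElements (G : Type*) [Group G] : Prop :=
  ∃ a b : G, Subgroup.closure {a, b} = ⊤

/-- The group `G` is generated by three involutions (elements of order exactly two). -/
def GeneratedByThreeInvolutions (G : Type*) [Group G] : Prop :=
  ∃ a b c : G, orderOf a = 2 ∧ orderOf b = 2 ∧ orderOf c = 2 ∧
    Subgroup.closure {a, b, c} = ⊤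

/-- `Sp(2h; ℤ₂)`: the `2h × 2h` matrices over `ℤ₂` preserving the standard symplectic form. -/
abbrev SpTwo (h : ℕ) : Type := Matrix.symplecticGroup (Fin h) (ZMod 2)

/-- The standard quadratic form `x₁y₁ + ⋯ + x_h y_h` on `ℤ₂^{2h}`. Its polarization is the
standard symplectic form. -/
def stdQuad (h : ℕ) (v : Fin h ⊕ Fin h → ZMod 2) : ZMod 2 :=
  ∑ i, v (Sum.inl i) * v (Sum.inr i)

theorem stdQuad_add (h : ℕ) (v w : Fin h ⊕ Fin h → ZMod 2) :
    stdQuad h (v + w) = stdQuad h v + stdQuad h w + v ⬝ᵥ (J (Fin h) (ZMod 2) *ᵥ w) := by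
  have hJ : v ⬝ᵥ (J (Fin h) (ZMod 2) *ᵥ w) =
      ∑ i, (v (Sum.inl i) * w (Sum.inr i) + v (Sum.inr i) * w (Sum.inl i)) := by
    rw [J, fromBlocks_mulVec, dotProduct, Fintype.sum_sum_type, Finset.sum_add_distrib]
    simp [neg_mulVec, CharTwo.neg_eq]
  rw [hJ]
  simp only [stdQuad, ← Finset.sum_add_distrib]
  refine Finset.sum_congr rfl fun i _ => ?_
  simp only [Pi.add_apply]
  ring

theorem symplectic_preserves (h : ℕ) (A : SpTwo h) (v w : Fin h ⊕ Fin h → ZMod 2) :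
    (A.1 *ᵥ v) ⬝ᵥ (J (Fin h) (ZMod 2) *ᵥ (A.1 *ᵥ w)) =
      v ⬝ᵥ (J (Fin h) (ZMod 2) *ᵥ w) := by
  have hA := SymplecticGroup.mem_iff'.1 A.2
  rw [← vecMul_transpose, ← dotProduct_mulVec, mulVec_mulVec, mulVec_mulVec, hA]

/-- The elementary abelian group `ℤ₂^{2h+1}`, written as `ℤ₂^{2h} × ℤ₂`. -/
abbrev ElemAb (h : ℕ) : Type := (Fin h ⊕ Fin h → ZMod 2) × ZMod 2

/-- The action of a symplectic matrix `A` on `ℤ₂^{2h+1}`, `(v, t) ↦ (A v, t + q(A v) + q(v))`,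
where `q` is the standard quadratic form. In characteristic two `v ↦ q(A v) + q(v)` is linear, and
`(v, t) ↦ q(v) + t²` is the invariant quadratic form: this is the natural module of the orthogonal
group `O(2h+1; ℤ₂) ≅ Sp(2h; ℤ₂)`. With it, `Sp(2h; ℤ₂) ⋉ ℤ₂^{2h+1}` is the stabilizer of a
nonzero vector in `Sp(2h+2; ℤ₂)`, i.e. the group of all automorphisms of
`H₁(N_{2h+2}; ℤ₂) = ℤ₂^{2h+2}` that preserve the mod 2 intersection pairing. -/
def spActEquiv (h : ℕ) (A : SpTwo h) : ElemAb h ≃+ ElemAb h where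
  toFun x := (A.1 *ᵥ x.1, x.2 + stdQuad h (A.1 *ᵥ x.1) + stdQuad h x.1)
  invFun x := ((A⁻¹).1 *ᵥ x.1, x.2 + stdQuad h ((A⁻¹).1 *ᵥ x.1) + stdQuad h x.1)
  left_inv x := by
    have hA : (A⁻¹).1 * A.1 = 1 := congrArg Subtype.val (inv_mul_cancel A)
    ext1
    · simp only [mulVec_mulVec, hA, one_mulVec]
    · simp only [mulVec_mulVec, hA, one_mulVec]
      linear_combination CharTwo.add_self_eq_zero (stdQuad h (A.1 *ᵥ x.1)) +
        CharTwo.add_self_eq_zero (stdQuad h x.1)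
  right_inv x := by
    have hA : A.1 * (A⁻¹).1 = 1 := congrArg Subtype.val (mul_inv_cancel A)
    ext1
    · simp only [mulVec_mulVec, hA, one_mulVec]
    · simp only [mulVec_mulVec, hA, one_mulVec]
      linear_combination CharTwo.add_self_eq_zero (stdQuad h ((A⁻¹).1 *ᵥ x.1)) +
        CharTwo.add_self_eq_zero (stdQuad h x.1)
  map_add' x y := by
    ext1
    · simp only [Prod.fst_add, mulVec_add]
    · simp only [Prod.fst_add, Prod.snd_add, mulVec_add, stdQuad_add, symplectic_preserves]
      linear_combination CharTwo.add_self_eq_zero (x.1 ⬝ᵥ (J (Fin h) (ZMod 2) *ᵥ y.1))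

/-- The action of `Sp(2h; ℤ₂)` on `ℤ₂^{2h+1}` by group automorphisms. -/
def spAct (h : ℕ) : SpTwo h →* MulAut (Multiplicative (ElemAb h)) where
  toFun A := AddEquiv.toMultiplicative (spActEquiv h A)
  map_one' := by
    ext1 x
    change Multiplicative.ofAdd (spActEquiv h 1 x.toAdd) = x
    refine congrArg Multiplicative.ofAdd (a₂ := x.toAdd) ?_
    ext1
    · simp [spActEquiv]
    · simp [spActEquiv, add_assoc, CharTwo.add_self_eq_zero]
  map_mul' A B := by
    ext1 x
    change Multiplicative.ofAdd (spActEquiv h (A * B) x.toAdd) =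
      Multiplicative.ofAdd (spActEquiv h A (spActEquiv h B x.toAdd))
    refine congrArg Multiplicative.ofAdd ?_
    ext1
    · simp [spActEquiv, mulVec_mulVec]
    · simp only [spActEquiv, AddEquiv.coe_mk, Equiv.coe_fn_mk, mulVec_mulVec, Submonoid.coe_mul]
      linear_combination -CharTwo.add_self_eq_zero (stdQuad h (B.1 *ᵥ x.toAdd.1))

/-- The semidirect product `Sp(2h; ℤ₂) ⋉ ℤ₂^{2h+1}`. -/
abbrev SpSemidirect (h : ℕ) : Type := Multiplicative (ElemAb h) ⋊[spAct h] SpTwo h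

/-! Both families are isometry groups of the dot product on `ℤ₂^n`. Since `x ⬝ x = x ⬝ 1`, every
isometry fixes the all-ones vector `1`. For `n = 2h + 1`, `1` is not isotropic and its complement is
symplectic of dimension `2h`, so the isometry group is `Sp(2h; ℤ₂)`. For `n = 2h + 2`, `1` is
isotropic, `1^⊥/1` is symplectic of dimension `2h`, and the Eichler transformations, parametrized by
`ℤ₂^{2h+1}`, supply the normal factor (`semidirectExt_range`).

It remains to generate the isometry group for `n ≥ 13` (`generated_of_range_eq_dotIsometry`). Let
`σ` be the rotation of the coordinates and `z` the transvection `T` along `e₀+e₁+e₃+e₄` times `(9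
11)(6 7)`. In `z · σzσ⁻¹` all factors commute except `(6 7)` and `(7 8)`, so its square is a
3-cycle. Its conjugates under `σ` are 3-cycles on consecutive points; they produce the even
permutation `(9 11)(6 7)`, which splits off `T`. Conjugating `T` by a 3-cycle and then by `T` yields
the transvection along `e₂+e₃`, a transposition; with `σ` it gives all permutations. These, with the
transvections of weight four, generate everything, by lowering the weight of images of basis
vectors. Finally `σ` is a product of two dihedral reflections, which together with `z` are the three
involutions. -/

theorem zmod_two_eq_one {a : ZMod 2} (h : a ≠ 0) : a = 1 := by
  revert a; decide

theorem zmod_two_mul_self (a : ZMod 2) : a * a = a := by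
  revert a; decide

/-! ### Isometries of the dot product: permutations and transvections -/

/-- The linear automorphisms of `ℤ₂^ι` that preserve the dot product. -/
def dotIsometry (ι : Type*) [Fintype ι] :
    Subgroup ((ι → ZMod 2) ≃ₗ[ZMod 2] (ι → ZMod 2)) where
  carrier := {M | ∀ x y, M x ⬝ᵥ M y = x ⬝ᵥ y}
  mul_mem' {M N} hM hN x y := (hM _ _).trans (hN _ _)
  one_mem' _ _ := rfl
  inv_mem' {M} hM x y := by
    rw [← hM]
    exact congrArg₂ _ (M.apply_symm_apply x) (M.apply_symm_apply y)

/-- The action of permutations of `ι` on `ℤ₂^ι`. -/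
def permIsometry (ι : Type*) :
    Equiv.Perm ι →* ((ι → ZMod 2) ≃ₗ[ZMod 2] (ι → ZMod 2)) where
  toFun π := LinearEquiv.funCongrLeft (ZMod 2) (ZMod 2) π.symm
  map_one' := rfl
  map_mul' _ _ := rfl

theorem permIsometry_apply {ι : Type*} (π : Equiv.Perm ι) (x : ι → ZMod 2) (i : ι) :
    permIsometry ι π x i = x (π⁻¹ i) := rfl

theorem permIsometry_single {ι : Type*} [DecidableEq ι] (π : Equiv.Perm ι) (i : ι) :
    permIsometry ι π (Pi.single i 1) = Pi.single (π i) 1 := by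
  ext j
  simp only [permIsometry_apply, Pi.single_apply, Equiv.Perm.inv_eq_iff_eq, @eq_comm _ j]

theorem permIsometry_injective (ι : Type*) : Function.Injective (permIsometry ι) := by
  classical
  intro π ρ h
  ext i
  have := congrFun (DFunLike.congr_fun h (Pi.single i 1)) (π i)
  simpa [permIsometry_single, Pi.single_apply] using this

theorem permIsometry_mem {ι : Type*} [Fintype ι] (π : Equiv.Perm ι) :
    permIsometry ι π ∈ dotIsometry ι := fun x y =>
  Equiv.sum_comp π⁻¹ fun i => x i * y i

theorem vec_add_self {ι : Type*} (x : ι → ZMod 2) : x + x = 0 := by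
  ext i
  exact CharTwo.add_self_eq_zero _

/-- The transvection `x ↦ x + (x ⬝ w) w` along an isotropic vector `w`. -/
def transvec {ι : Type*} [Fintype ι] (w : ι → ZMod 2) (hw : w ⬝ᵥ w = 0) :
    (ι → ZMod 2) ≃ₗ[ZMod 2] (ι → ZMod 2) :=
  LinearEquiv.ofInvolutive
    { toFun := fun x => x + (x ⬝ᵥ w) • w
      map_add' := fun x y => by rw [add_dotProduct, add_smul]; abel
      map_smul' := fun r x => by
        simp only [smul_dotProduct, smul_add, smul_assoc, RingHom.id_apply] }
    fun x => by
      simp only [LinearMap.coe_mk, AddHom.coe_mk, add_dotProduct, smul_dotProduct, hw,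
        smul_zero, add_zero, add_assoc, vec_add_self]

section transvec

variable {ι : Type*} [Fintype ι]

theorem transvec_apply (w : ι → ZMod 2) (hw : w ⬝ᵥ w = 0) (x : ι → ZMod 2) :
    transvec w hw x = x + (x ⬝ᵥ w) • w := rfl

theorem transvec_mul_self (w : ι → ZMod 2) (hw : w ⬝ᵥ w = 0) :
    transvec w hw * transvec w hw = 1 := by
  ext1 x
  change transvec w hw (transvec w hw x) = x
  simp only [transvec_apply, add_dotProduct, smul_dotProduct, hw,
        smul_zero, add_zero, add_assoc, vec_add_self]

theorem transvec_mem (w : ι → ZMod 2) (hw : w ⬝ᵥ w = 0) : transvec w hw ∈ dotIsometry ι := by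
  intro x y
  simp only [transvec_apply, add_dotProduct, dotProduct_add, smul_dotProduct, dotProduct_smul, hw,
    smul_eq_mul, dotProduct_comm w y]
  linear_combination CharTwo.add_self_eq_zero ((x ⬝ᵥ w) * (y ⬝ᵥ w))

theorem conj_transvec {M : (ι → ZMod 2) ≃ₗ[ZMod 2] (ι → ZMod 2)} (hM : M ∈ dotIsometry ι)
    {w w' : ι → ZMod 2} (hw : w ⬝ᵥ w = 0) (hw' : w' ⬝ᵥ w' = 0) (h : M w = w') :
    M * transvec w hw * M⁻¹ = transvec w' hw' := by
  subst h
  rw [mul_inv_eq_iff_eq_mul]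
  ext1 x
  change M (transvec w hw x) = transvec (M w) hw' (M x)
  rw [transvec_apply, transvec_apply, hM, map_add, map_smul]

theorem transvec_commute {w u : ι → ZMod 2} (hw : w ⬝ᵥ w = 0) (hu : u ⬝ᵥ u = 0)
    (h : u ⬝ᵥ w = 0) : Commute (transvec w hw) (transvec u hu) := by
  have := conj_transvec (transvec_mem w hw) hu hu (by rw [transvec_apply, h, zero_smul, add_zero])
  exact mul_inv_eq_iff_eq_mul.1 this

end transvec

/-- Both `e_i` and `e_j` pair to one with `e_i + e_j`, so they are exchanged; all other basis
vectors pair to zero. This is how transvections produce permutations. -/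
theorem transvec_swap {ι : Type*} [Fintype ι] [DecidableEq ι] {i j : ι} (hij : i ≠ j)
    (h : (Pi.single i 1 + Pi.single j 1 : ι → ZMod 2) ⬝ᵥ (Pi.single i 1 + Pi.single j 1) = 0) :
    transvec _ h = permIsometry ι (Equiv.swap i j) := by
  apply LinearEquiv.toLinearMap_injective
  refine LinearMap.pi_ext' fun k => LinearMap.ext_ring ?_
  simp only [LinearMap.comp_apply, LinearMap.coe_single, LinearEquiv.coe_coe, permIsometry_single,
    transvec_apply, dotProduct_add, single_one_dotProduct]
  rcases eq_or_ne k i with rfl | hi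
  · simp [hij, ← add_assoc, vec_add_self]
  rcases eq_or_ne k j with rfl | hj
  · rw [Equiv.swap_apply_right]
    simp [hi, add_left_comm, vec_add_self]
  · simp [hi, hj, Equiv.swap_apply_of_ne_of_ne]

/-- The sum of four basis vectors. -/
def fourSum {ι : Type*} [DecidableEq ι] (a b c d : ι) : ι → ZMod 2 :=
  Pi.single a 1 + Pi.single b 1 + Pi.single c 1 + Pi.single d 1

theorem dotProduct_fourSum {ι : Type*} [Fintype ι] [DecidableEq ι] (x : ι → ZMod 2)
    (a b c d : ι) : x ⬝ᵥ fourSum a b c d = x a + x b + x c + x d := by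
  simp [fourSum, dotProduct_add]

/-- Because `x ⬝ x = x ⬝ 1`, this is the parity of four, whether or not the indices are distinct. -/
theorem fourSum_isotropic {ι : Type*} [Fintype ι] [DecidableEq ι] (a b c d : ι) :
    fourSum a b c d ⬝ᵥ fourSum a b c d = 0 := by
  have h : fourSum a b c d ⬝ᵥ fourSum a b c d = fourSum a b c d ⬝ᵥ 1 :=
    Finset.sum_congr rfl fun i _ => by rw [zmod_two_mul_self, Pi.one_apply, mul_one]
  rw [h, dotProduct_comm, dotProduct_fourSum]
  rfl

theorem permIsometry_fourSum {ι : Type*} [DecidableEq ι] (π : Equiv.Perm ι) (a b c d : ι) :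
    permIsometry ι π (fourSum a b c d) = fourSum (π a) (π b) (π c) (π d) := by
  simp only [fourSum, map_add, permIsometry_single]

theorem dotProduct_self_eq_card {ι : Type*} [Fintype ι] (f : ι → ZMod 2) :
    f ⬝ᵥ f = ((Finset.univ.filter fun i => f i ≠ 0).card : ZMod 2) := by
  rw [Finset.card_filter, Nat.cast_sum, dotProduct]
  refine Finset.sum_congr rfl fun i _ => ?_
  rw [zmod_two_mul_self]
  split_ifs with h
  · simp [zmod_two_eq_one h]
  · simpa using h

/-! ### Generation by permutations and transvections of weight four -/

section generation

variable {ι : Type*} [Fintype ι] [DecidableEq ι]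
  (H : Subgroup ((ι → ZMod 2) ≃ₗ[ZMod 2] (ι → ZMod 2)))

/-- The points `a`, `b`, `c` leave the support and only `q` enters. -/
theorem card_support_add_fourSum {f : ι → ZMod 2} {a b c q : ι} (ha : f a ≠ 0) (hb : f b ≠ 0)
    (hc : f c ≠ 0) (hab : a ≠ b) (hac : a ≠ c) (hbc : b ≠ c) (hq : f q = 0) :
    (Finset.univ.filter fun i => (f + fourSum a b c q) i ≠ 0).card <
      (Finset.univ.filter fun i => f i ≠ 0).card := by
  have haq : a ≠ q := fun h => ha (h ▸ hq)
  have hbq : b ≠ q := fun h => hb (h ▸ hq)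
  have hcq : c ≠ q := fun h => hc (h ▸ hq)
  set F := Finset.univ.filter fun i => f i ≠ 0
  have hsub : (Finset.univ.filter fun i => (f + fourSum a b c q) i ≠ 0) ⊆
      insert q (F \ {a, b, c}) := by
    intro i hi
    have hi' := (Finset.mem_filter.1 hi).2
    by_cases h : i = q
    · simp [h]
    rw [Finset.mem_insert, Finset.mem_sdiff]
    refine .inr ⟨?_, ?_⟩
    · refine Finset.mem_filter.2 ⟨Finset.mem_univ _, fun h0 => hi' ?_⟩
      have h1 : i ≠ a := fun h => ha (h ▸ h0)
      have h2 : i ≠ b := fun h => hb (h ▸ h0)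
      have h3 : i ≠ c := fun h => hc (h ▸ h0)
      simp [fourSum, h0, h, h1, h2, h3]
    · intro hm
      simp only [Finset.mem_insert, Finset.mem_singleton] at hm
      apply hi'
      rcases hm with rfl | rfl | rfl
      · simp [fourSum, hab, hac, haq, zmod_two_eq_one ha]; decide
      · simp [fourSum, hab.symm, hbc, hbq, zmod_two_eq_one hb]; decide
      · simp [fourSum, hac.symm, hbc.symm, hcq, zmod_two_eq_one hc]; decide
  have habc : ({a, b, c} : Finset ι) ⊆ F := by
    intro i hi
    simp only [Finset.mem_insert, Finset.mem_singleton] at hi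
    refine Finset.mem_filter.2 ⟨Finset.mem_univ _, ?_⟩
    rcases hi with rfl | rfl | rfl <;> assumption
  have h3 : ({a, b, c} : Finset ι).card = 3 := Finset.card_eq_three.2 ⟨a, b, c, hab, hac, hbc, rfl⟩
  have h4 := (Finset.card_le_card hsub).trans (Finset.card_insert_le _ _)
  have h5 := Finset.card_sdiff_add_card_eq_card habc
  omega

/-- Permutations and transvections along vectors of weight four generate all isometries. -/
theorem dotIsometry_le_of_perm_of_transvec (hperm : ∀ π, permIsometry ι π ∈ H)
    (htr : ∀ a b c d : ι, a ≠ b → a ≠ c → a ≠ d → b ≠ c → b ≠ d → c ≠ d →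
      transvec (fourSum a b c d) (fourSum_isotropic a b c d) ∈ H) : dotIsometry ι ≤ H := by
  -- Outer induction on the number of basis vectors not yet fixed; `step` is an inner induction on
  -- the weight of the image of the next one, `e_k`.
  have key : ∀ (n : ℕ) (S : Finset ι), Sᶜ.card = n → ∀ M ∈ dotIsometry ι,
      (∀ i ∈ S, M (Pi.single i 1) = Pi.single i 1) → M ∈ H := by
    intro n
    induction n with
    | zero =>
      intro S hS M _ hfix
      have hS' : S = Finset.univ := by simpa using hS
      have : M = 1 := by
        apply LinearEquiv.toLinearMap_injective
        refine LinearMap.pi_ext' fun k => LinearMap.ext_ring ?_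
        exact hfix k (hS' ▸ Finset.mem_univ k)
      exact this ▸ H.one_mem
    | succ n ih =>
      intro S hS
      obtain ⟨k, hk⟩ : Sᶜ.Nonempty := by rw [← Finset.card_pos]; omega
      have hkS : k ∉ S := Finset.mem_compl.1 hk
      have step : ∀ (m : ℕ), ∀ M ∈ dotIsometry ι,
          (∀ i ∈ S, M (Pi.single i 1) = Pi.single i 1) →
          (Finset.univ.filter fun i => M (Pi.single k 1) i ≠ 0).card = m → M ∈ H := by
        intro m
        induction m using Nat.strong_induction_on with
        | _ m ihm =>
        intro M hM hfix hm
        have hvan : ∀ j, j ∉ S → ∀ i ∈ S, M (Pi.single j 1) i = 0 := by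
          intro j hj i hi
          have := hM (Pi.single j 1) (Pi.single i 1)
          rw [hfix i hi] at this
          simp only [dotProduct_single_one] at this
          rw [this, Pi.single_eq_of_ne]
          rintro rfl; exact hj hi
        set f := M (Pi.single k 1) with hf
        have hff : f ⬝ᵥ f = 1 := by rw [hf, hM]; simp
        have hodd : Odd m := by
          rw [dotProduct_self_eq_card, hm] at hff
          exact (ZMod.natCast_eq_one_iff_odd).1 hff
        rcases eq_or_ne m 1 with rfl | hm1
        · obtain ⟨p, hp⟩ := Finset.card_eq_one.1 hm
          have hfp : f = Pi.single p 1 := by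
            ext i
            have := Finset.ext_iff.1 hp i
            simp only [Finset.mem_filter, Finset.mem_univ, true_and, Finset.mem_singleton] at this
            by_cases h : i = p
            · subst h; simpa using zmod_two_eq_one (this.2 rfl)
            · rw [Pi.single_eq_of_ne h]; by_contra h0; exact h (this.1 h0)
          have hpS : p ∉ S := fun h => by
            have := hvan k hkS p h
            rw [← hf, hfp] at this; simp at this
          have hmem : permIsometry ι (Equiv.swap k p) * M ∈ H := by
            refine ih (insert k S) ?_ _ (mul_mem (permIsometry_mem _) hM) ?_
            · rw [Finset.compl_insert, Finset.card_erase_of_mem hk]; omega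
            · intro i hi
              change permIsometry ι (Equiv.swap k p) (M (Pi.single i 1)) = _
              rcases Finset.mem_insert.1 hi with hik | hiS
              · rw [hik, ← hf, hfp, permIsometry_single, Equiv.swap_apply_right]
              · rw [hfix i hiS, permIsometry_single, Equiv.swap_apply_of_ne_of_ne]
                · rintro rfl; exact hkS hiS
                · rintro rfl; exact hpS hiS
          exact (H.mul_mem_cancel_left (hperm _)).1 hmem
        · have h2 : 2 < (Finset.univ.filter fun i => f i ≠ 0).card := by
            rw [hm]; obtain ⟨r, hr⟩ := hodd; omega
          obtain ⟨a, ha, b, hb, c, hc, hab, hac, hbc⟩ := Finset.two_lt_card.1 h2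
          simp only [Finset.mem_filter, Finset.mem_univ, true_and] at ha hb hc
          have hnS : ∀ i, f i ≠ 0 → i ∉ S := fun i hi h => hi (hvan k hkS i h)
          -- Otherwise `f` equals `1` off `S`, so `x ⬝ f = x ⬝ x` for `x` supported there; `x = M
          -- e_j` with `j ≠ k` gives `e_j ⬝ e_k = 1`, absurd.
          obtain ⟨q, hqS, hq⟩ : ∃ q, q ∉ S ∧ f q = 0 := by
            by_contra! hno
            obtain ⟨j, hjS, hjk⟩ : ∃ j, j ∉ S ∧ j ≠ k := by
              rcases eq_or_ne a k with rfl | h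
              · exact ⟨b, hnS b hb, hab.symm⟩
              · exact ⟨a, hnS a ha, h⟩
            have h1 : M (Pi.single j 1) ⬝ᵥ f = M (Pi.single j 1) ⬝ᵥ M (Pi.single j 1) := by
              refine Finset.sum_congr rfl fun i _ => ?_
              by_cases hi : i ∈ S
              · rw [hvan j hjS i hi, zero_mul, zero_mul]
              · rw [zmod_two_mul_self, zmod_two_eq_one (hno i hi), mul_one]
            rw [hf, hM, hM] at h1
            simp [hjk.symm] at h1
          have hT := transvec_mem _ (fourSum_isotropic a b c q)
          have hTH := htr a b c q hab hac (fun h => ha (h ▸ hq)) hbc (fun h => hb (h ▸ hq))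
            (fun h => hc (h ▸ hq))
          refine (H.mul_mem_cancel_left hTH).1 (ihm _ ?_ _ (mul_mem hT hM) ?_ rfl)
          · rw [← hm]
            have : (transvec _ (fourSum_isotropic a b c q) * M) (Pi.single k 1) =
                f + fourSum a b c q := by
              change transvec _ (fourSum_isotropic a b c q) f = _
              rw [transvec_apply, dotProduct_fourSum, hq, zmod_two_eq_one ha, zmod_two_eq_one hb,
                zmod_two_eq_one hc]
              congr 1
              exact one_smul _ _
            rw [this]
            exact card_support_add_fourSum ha hb hc hab hac hbc hq
          · intro i hi
            change transvec _ (fourSum_isotropic a b c q) (M (Pi.single i 1)) = _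
            have hne : ∀ r, r ∉ S → r ≠ i := fun r hr h => hr (h ▸ hi)
            rw [hfix i hi, transvec_apply, dotProduct_fourSum]
            simp [hne a (hnS a ha), hne b (hnS b hb), hne c (hnS c hc), hne q hqS]
      exact fun M hM hfix => step _ M hM hfix rfl
  exact fun M hM => key _ ∅ rfl M hM (by simp)

end generation

/-! ### Generation by a cycle and one involution -/

/-- The commuting involutions `a`, `b` cancel in the square. Used twice on `z · σzσ⁻¹`: to strip the
transvections, then the swaps `(9 11)` and `(10 12)`. -/
theorem sq_of_commute {G : Type*} [Group G] {a b c d : G} (hab : Commute a b) (hac : Commute a c)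
    (had : Commute a d) (hbc : Commute b c) (hbd : Commute b d) (ha : a * a = 1)
    (hb : b * b = 1) : (a * c * (b * d)) * (a * c * (b * d)) = c * d * (c * d) := by
  have h1 : a * c * (b * d) = a * b * (c * d) := by
    rw [mul_assoc, ← mul_assoc c, ← hbc.eq, mul_assoc, ← mul_assoc a]
  have h2 : Commute (a * b) (c * d) := (hac.mul_right had).mul_left (hbc.mul_right hbd)
  rw [h1, h2.symm.mul_mul_mul_comm, hab.symm.mul_mul_mul_comm, ha, hb, one_mul, one_mul]

theorem swap_commute_of_ne {α : Type*} [DecidableEq α] {a b c d : α} (hac : a ≠ c) (had : a ≠ d)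
    (hbc : b ≠ c) (hbd : b ≠ d) : Commute (Equiv.swap a b) (Equiv.swap c d) := by
  have := Equiv.swap_apply_apply (Equiv.swap a b) c d
  rw [Equiv.swap_apply_of_ne_of_ne hac.symm hbc.symm,
    Equiv.swap_apply_of_ne_of_ne had.symm hbd.symm] at this
  exact (eq_mul_inv_iff_mul_eq.1 this).symm

theorem swap_mul_swap_sq {α : Type*} [DecidableEq α] {a b c : α} (hab : a ≠ b) (hac : a ≠ c)
    (hbc : b ≠ c) : Equiv.swap a b * Equiv.swap b c * (Equiv.swap a b * Equiv.swap b c) =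
      Equiv.swap b c * Equiv.swap a b := by
  have h1 := Equiv.swap_mul_swap_mul_swap hab hac
  have h2 := Equiv.swap_mul_swap_mul_swap hbc.symm hac.symm
  rw [Equiv.swap_comm c b, Equiv.swap_comm b a] at h2
  rw [← mul_assoc, h2, Equiv.swap_comm a c, ← h1, mul_assoc, Equiv.swap_mul_self, mul_one]

/-- The symmetric group is 4-transitive, and conjugation carries transvections to transvections. -/
theorem transvec_fourSum_mem_of_perm {ι : Type*} [Fintype ι] [DecidableEq ι]
    {H : Subgroup ((ι → ZMod 2) ≃ₗ[ZMod 2] (ι → ZMod 2))} (hperm : ∀ π, permIsometry ι π ∈ H)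
    {a b c d : ι} (hab : a ≠ b) (hac : a ≠ c) (had : a ≠ d) (hbc : b ≠ c) (hbd : b ≠ d)
    (hcd : c ≠ d) (hT : transvec (fourSum a b c d) (fourSum_isotropic a b c d) ∈ H)
    {a' b' c' d' : ι} (hab' : a' ≠ b') (hac' : a' ≠ c') (had' : a' ≠ d') (hbc' : b' ≠ c')
    (hbd' : b' ≠ d') (hcd' : c' ≠ d') :
    transvec (fourSum a' b' c' d') (fourSum_isotropic a' b' c' d') ∈ H := by
  have inj : ∀ {a b c d : ι}, a ≠ b → a ≠ c → a ≠ d → b ≠ c → b ≠ d → c ≠ d →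
      Function.Injective ![a, b, c, d] := by
    intro a b c d hab hac had hbc hbd hcd i j
    fin_cases i <;> fin_cases j <;> simp [*, Ne.symm]
  obtain ⟨π, hπ⟩ := MulAction.isMultiplyPretransitive_iff.1
    (Equiv.Perm.isMultiplyPretransitive ι 4) ⟨_, inj hab hac had hbc hbd hcd⟩
    ⟨_, inj hab' hac' had' hbc' hbd' hcd'⟩
  have e : ∀ i, π (![a, b, c, d] i) = ![a', b', c', d'] i := fun i => DFunLike.congr_fun hπ i
  have h : permIsometry ι π (fourSum a b c d) = fourSum a' b' c' d' := by
    rw [permIsometry_fourSum]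
    exact congr (congr (congrArg₂ fourSum (e 0) (e 1)) (e 2)) (e 3)
  rw [← conj_transvec (permIsometry_mem π) (fourSum_isotropic a b c d) _ h]
  exact H.mul_mem (H.mul_mem (hperm π) hT) (H.inv_mem (hperm π))

theorem commute_permIsometry_transvec {ι : Type*} [Fintype ι] [DecidableEq ι] (π : Equiv.Perm ι)
    (a b c d : ι) (ha : π a = a) (hb : π b = b) (hc : π c = c) (hd : π d = d) :
    Commute (transvec (fourSum a b c d) (fourSum_isotropic a b c d)) (permIsometry ι π) := by
  have := conj_transvec (permIsometry_mem π) (fourSum_isotropic a b c d)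
    (fourSum_isotropic a b c d) (by rw [permIsometry_fourSum, ha, hb, hc, hd])
  exact (mul_inv_eq_iff_eq_mul.1 this).symm

/-- An involution which, together with a cyclic permutation through the points `p 0, p 1, …`,
generates the whole isometry group. -/
def mixedInvolution {ι : Type*} [Fintype ι] [DecidableEq ι] (p : ℕ → ι) :
    (ι → ZMod 2) ≃ₗ[ZMod 2] (ι → ZMod 2) :=
  transvec (fourSum (p 0) (p 1) (p 3) (p 4)) (fourSum_isotropic _ _ _ _) *
    permIsometry ι (Equiv.swap (p 9) (p 11) * Equiv.swap (p 6) (p 7))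

section cycle

variable {ι : Type*} [Fintype ι] [DecidableEq ι] {p : ℕ → ι}

theorem mixedInvolution_mem (p : ℕ → ι) : mixedInvolution p ∈ dotIsometry ι :=
  mul_mem (transvec_mem _ _) (permIsometry_mem _)

theorem mixedInvolution_mul_self (hp : ∀ i j, i < 13 → j < 13 → (p i = p j ↔ i = j)) :
    mixedInvolution p * mixedInvolution p = 1 := by
  have hc := commute_permIsometry_transvec
    (Equiv.swap (p 9) (p 11) * Equiv.swap (p 6) (p 7)) (p 0) (p 1) (p 3) (p 4)
    (by simp [Equiv.swap_apply_def, hp]) (by simp [Equiv.swap_apply_def, hp])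
    (by simp [Equiv.swap_apply_def, hp]) (by simp [Equiv.swap_apply_def, hp])
  have hs : Commute (Equiv.swap (p 9) (p 11)) (Equiv.swap (p 6) (p 7)) :=
    swap_commute_of_ne (by simp [hp]) (by simp [hp]) (by simp [hp]) (by simp [hp])
  rw [mixedInvolution, hc.symm.mul_mul_mul_comm, transvec_mul_self, one_mul, ← map_mul,
    hs.symm.mul_mul_mul_comm, Equiv.swap_mul_self, Equiv.swap_mul_self, one_mul, map_one]

theorem mixedInvolution_ne_one (hp : ∀ i j, i < 13 → j < 13 → (p i = p j ↔ i = j)) :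
    mixedInvolution p ≠ 1 := by
  intro h
  have := congrFun (DFunLike.congr_fun h (Pi.single (p 6) 1)) (p 7)
  change transvec _ (fourSum_isotropic (p 0) (p 1) (p 3) (p 4))
    (permIsometry ι _ (Pi.single (p 6) 1)) (p 7) =
    (Pi.single (p 6) 1 : ι → ZMod 2) (p 7) at this
  rw [permIsometry_single, transvec_apply, dotProduct_fourSum] at this
  simp [Equiv.swap_apply_def, hp] at this

variable {σ : Equiv.Perm ι} {H : Subgroup ((ι → ZMod 2) ≃ₗ[ZMod 2] (ι → ZMod 2))}

theorem conj_mixedInvolution (hσp : ∀ k, σ (p k) = p (k + 1)) :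
    permIsometry ι σ * mixedInvolution p * (permIsometry ι σ)⁻¹ =
      transvec (fourSum (p 1) (p 2) (p 4) (p 5)) (fourSum_isotropic _ _ _ _) *
        permIsometry ι (Equiv.swap (p 10) (p 12) * Equiv.swap (p 7) (p 8)) := by
  have h1 := conj_transvec (permIsometry_mem σ) (fourSum_isotropic (p 0) (p 1) (p 3) (p 4))
    (fourSum_isotropic (p 1) (p 2) (p 4) (p 5)) (by simp only [permIsometry_fourSum, hσp])
  have h2 : ∀ i j, Equiv.swap (p (i + 1)) (p (j + 1)) = σ * Equiv.swap (p i) (p j) * σ⁻¹ :=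
    fun i j => by rw [← Equiv.swap_apply_apply, hσp, hσp]
  rw [← h1, h2 9 11, h2 6 7, mixedInvolution]
  simp only [map_mul, map_inv]
  group

theorem swap_mul_swap_mem (hσp : ∀ k, σ (p k) = p (k + 1))
    (hp : ∀ i j, i < 13 → j < 13 → (p i = p j ↔ i = j)) (hσ : permIsometry ι σ ∈ H)
    (hz : mixedInvolution p ∈ H) (k : ℕ) :
    permIsometry ι (Equiv.swap (p (k + 1)) (p (k + 2)) * Equiv.swap (p k) (p (k + 1))) ∈ H := by
  have shift : ∀ k, permIsometry ι (Equiv.swap (p (k + 1 + 1)) (p (k + 1 + 2)) *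
        Equiv.swap (p (k + 1)) (p (k + 1 + 1))) ∈ H ↔
      permIsometry ι (Equiv.swap (p (k + 1)) (p (k + 2)) * Equiv.swap (p k) (p (k + 1))) ∈ H := by
    intro k
    have h2 : ∀ i j, Equiv.swap (p (i + 1)) (p (j + 1)) = σ * Equiv.swap (p i) (p j) * σ⁻¹ :=
      fun i j => by rw [← Equiv.swap_apply_apply, hσp, hσp]
    have h3 : Equiv.swap (p (k + 1 + 1)) (p (k + 1 + 2)) * Equiv.swap (p (k + 1)) (p (k + 1 + 1)) =
        σ * (Equiv.swap (p (k + 1)) (p (k + 2)) * Equiv.swap (p k) (p (k + 1))) * σ⁻¹ := by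
      rw [show k + 1 + 2 = k + 2 + 1 from rfl, h2 (k + 1) (k + 1 + 1), h2 k (k + 1)]
      group
    rw [h3, map_mul, map_mul, map_inv, H.mul_mem_cancel_right (H.inv_mem hσ),
      H.mul_mem_cancel_left hσ]
  have h6 : permIsometry ι (Equiv.swap (p (6 + 1)) (p (6 + 2)) *
      Equiv.swap (p 6) (p (6 + 1))) ∈ H := by
    have hz1 := H.mul_mem (H.mul_mem hσ hz) (H.inv_mem hσ)
    rw [conj_mixedInvolution hσp] at hz1
    have hmem := H.mul_mem (H.mul_mem hz hz1) (H.mul_mem hz hz1)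
    rw [mixedInvolution, sq_of_commute, ← map_mul, ← map_mul, sq_of_commute,
      swap_mul_swap_sq] at hmem
    · exact hmem
    iterate 3 simp [hp]
    iterate 5 exact swap_commute_of_ne (by simp [hp]) (by simp [hp]) (by simp [hp]) (by simp [hp])
    iterate 2 exact Equiv.swap_mul_self _ _
    -- The supports `{0,1,3,4}` and `{1,2,4,5}` meet in two points, so the vectors are orthogonal.
    · refine transvec_commute _ _ ?_
      rw [dotProduct_fourSum]
      simp [fourSum, hp]
      decide
    iterate 4
      apply commute_permIsometry_transvec <;> simp [Equiv.swap_apply_def, hp]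
    iterate 2 exact transvec_mul_self _ _
  -- Conjugation by `σ⁻¹` brings the 3-cycle from `6` down to `0`, whence all `k` follow upwards.
  have h0 := (shift 0).1 ((shift 1).1 ((shift 2).1 ((shift 3).1 ((shift 4).1 ((shift 5).1 h6)))))
  induction k with
  | zero => exact h0
  | succ k ih => exact (shift k).2 ih

theorem transvec_fourSum_mem_of_cycle (hσp : ∀ k, σ (p k) = p (k + 1))
    (hp : ∀ i j, i < 13 → j < 13 → (p i = p j ↔ i = j)) (hσ : permIsometry ι σ ∈ H)
    (hz : mixedInvolution p ∈ H) :
    transvec (fourSum (p 0) (p 1) (p 3) (p 4)) (fourSum_isotropic _ _ _ _) ∈ H := by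
  have hs := swap_mul_swap_mem hσp hp hσ hz
  refine (H.mul_mem_cancel_right ?_).1 hz
  have hbraid : Equiv.swap (p 9) (p 11) =
      Equiv.swap (p 9) (p 10) * Equiv.swap (p 10) (p 11) * Equiv.swap (p 9) (p 10) := by
    have := Equiv.swap_mul_swap_mul_swap (x := p 11) (y := p 10) (z := p 9)
      (by simp [hp]) (by simp [hp])
    rw [← this, Equiv.swap_comm (p 10) (p 9), Equiv.swap_comm (p 10) (p 11)]
  have hinv : ∀ k, permIsometry ι (Equiv.swap (p k) (p (k + 1)) *
      Equiv.swap (p (k + 1)) (p (k + 2))) ∈ H := by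
    intro k
    have := H.inv_mem (hs k)
    rwa [← map_inv, _root_.mul_inv_rev, Equiv.swap_inv, Equiv.swap_inv] at this
  -- The product telescopes to `(9 10)(10 11)(9 10)(6 7) = (9 11)(6 7)`. The swap `(9 11)` in `z`
  -- makes its permutation part even, hence within reach of 3-cycles.
  have := H.mul_mem (H.mul_mem (H.mul_mem (hinv 9) (hs 8)) (hs 7)) (hs 6)
  simp only [← map_mul, Nat.reduceAdd] at this
  rw [hbraid]
  convert this using 2
  simp only [mul_assoc, Equiv.swap_mul_self_mul]

/-- A cyclic permutation and the involution `mixedInvolution` generate all isometries. -/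
theorem dotIsometry_le_of_cycle (hc : σ.IsCycle) (hsupp : σ.support = Finset.univ)
    (hσp : ∀ k, σ (p k) = p (k + 1)) (hp : ∀ i j, i < 13 → j < 13 → (p i = p j ↔ i = j))
    (hσ : permIsometry ι σ ∈ H) (hz : mixedInvolution p ∈ H) : dotIsometry ι ≤ H := by
  have hT := transvec_fourSum_mem_of_cycle hσp hp hσ hz
  have hs := H.inv_mem (swap_mul_swap_mem hσp hp hσ hz 1)
  rw [← map_inv, _root_.mul_inv_rev, Equiv.swap_inv, Equiv.swap_inv] at hs
  -- The 3-cycle sends `1, 3` to `2, 1`. The new support meets the old one in three points, so `T`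
  -- adds one vector to the other, leaving `e₂ + e₃`.
  have hT' := H.mul_mem (H.mul_mem hs hT) (H.inv_mem hs)
  rw [conj_transvec (permIsometry_mem _) _ (fourSum_isotropic (p 0) (p 2) (p 1) (p 4))
    (by rw [permIsometry_fourSum]; simp [Equiv.swap_apply_def, hp])] at hT'
  have hT'' := H.mul_mem (H.mul_mem hT hT') (H.inv_mem hT)
  have hsum : transvec (fourSum (p 0) (p 1) (p 3) (p 4)) (fourSum_isotropic _ _ _ _)
      (fourSum (p 0) (p 2) (p 1) (p 4)) = Pi.single (p 2) 1 + Pi.single (p 3) 1 := by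
    have h1 : fourSum (p 0) (p 2) (p 1) (p 4) ⬝ᵥ fourSum (p 0) (p 1) (p 3) (p 4) = 1 := by
      rw [dotProduct_fourSum]
      simp [fourSum, hp]
      decide
    rw [transvec_apply, h1, one_smul]
    have e0 := vec_add_self (Pi.single (p 0) 1 : ι → ZMod 2)
    have e1 := vec_add_self (Pi.single (p 1) 1 : ι → ZMod 2)
    have e4 := vec_add_self (Pi.single (p 4) 1 : ι → ZMod 2)
    rw [fourSum, fourSum]
    linear_combination e0 + e1 + e4
  have hiso : (Pi.single (p 2) 1 + Pi.single (p 3) 1 : ι → ZMod 2) ⬝ᵥ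
      (Pi.single (p 2) 1 + Pi.single (p 3) 1) = 0 := by
    simp [hp]
    decide
  rw [conj_transvec (transvec_mem _ _) _ hiso hsum, transvec_swap (by simp [hp])] at hT''
  have hperm : ∀ π, permIsometry ι π ∈ H := by
    have htop : Subgroup.closure {σ, Equiv.swap (p 2) (σ (p 2))} ≤ H.comap (permIsometry ι) := by
      rw [Subgroup.closure_le]
      rintro π (rfl | rfl)
      · exact hσ
      · rw [hσp]; exact hT''
    rw [Equiv.Perm.closure_cycle_adjacent_swap hc hsupp] at htop
    exact fun π => htop (Subgroup.mem_top π)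
  refine dotIsometry_le_of_perm_of_transvec H hperm fun a b c d hab hac had hbc hbd hcd => ?_
  exact transvec_fourSum_mem_of_perm hperm (by simp [hp]) (by simp [hp]) (by simp [hp])
    (by simp [hp]) (by simp [hp]) (by simp [hp]) hT hab hac had hbc hbd hcd

end cycle

/-! ### Two generators and three involutions of the isometry group -/

theorem finRotate_pow_apply_zero (n k : ℕ) (hk : k < n + 1) :
    (finRotate (n + 1) ^ k) 0 = ⟨k, hk⟩ := by
  induction k with
  | zero => rfl
  | succ k ih => rw [pow_succ', Equiv.Perm.mul_apply, ih (by omega), finRotate_of_lt (by omega)]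

/-- The product is the dihedral reflection `i ↦ -2 - i` modulo `n`. -/
theorem revPerm_mul_finRotate_sq (n : ℕ) :
    Fin.revPerm * finRotate n * (Fin.revPerm * finRotate n) = 1 := by
  cases n with
  | zero => exact Subsingleton.elim _ _
  | succ n =>
    ext i
    simp only [Equiv.Perm.mul_apply, Fin.revPerm_apply, Equiv.Perm.one_apply]
    have h1 := coe_finRotate i
    generalize finRotate (n + 1) i = a at *
    have h2 := coe_finRotate a.rev
    generalize finRotate (n + 1) a.rev = b at *
    have := i.is_lt
    simp only [Fin.ext_iff, Fin.val_rev, Fin.val_last] at *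
    split_ifs at h1 h2 <;> omega

/-- A group isomorphic to the isometry group of `ℤ₂^n` with the dot product is generated by two
elements and by three involutions. -/
theorem generated_of_range_eq_dotIsometry {G : Type*} [Group G] {n : ℕ} (hn : 13 ≤ n)
    (Φ : G →* ((Fin n → ZMod 2) ≃ₗ[ZMod 2] (Fin n → ZMod 2))) (hΦ : Function.Injective Φ)
    (hrange : Φ.range = dotIsometry (Fin n)) :
    GeneratedByTwoElements G ∧ GeneratedByThreeInvolutions G := by
  obtain ⟨m, rfl⟩ : ∃ m, n = m + 1 := ⟨n - 1, by omega⟩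
  -- As an orbit of the rotation, `p` satisfies `σ (p k) = p (k + 1)` also past the wrap-around,
  -- while `p k = k` for `k ≤ m`.
  set p : ℕ → Fin (m + 1) := fun k => (finRotate (m + 1) ^ k) 0 with hp_def
  have hσp : ∀ k, finRotate (m + 1) (p k) = p (k + 1) := fun k => by
    rw [hp_def]; simp only [pow_succ', Equiv.Perm.mul_apply]
  have hp : ∀ i j, i < 13 → j < 13 → (p i = p j ↔ i = j) := fun i j hi hj => by
    simp only [hp_def]
    rw [finRotate_pow_apply_zero m i (by omega), finRotate_pow_apply_zero m j (by omega),
      Fin.mk.injEq]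
  have top_of : ∀ H : Subgroup G, permIsometry _ (finRotate (m + 1)) ∈ H.map Φ →
      mixedInvolution p ∈ H.map Φ → H = ⊤ := by
    intro H h1 h2
    have := dotIsometry_le_of_cycle (isCycle_finRotate_of_le (by omega))
      (support_finRotate_of_le (by omega)) hσp hp h1 h2
    rw [← hrange, MonoidHom.range_eq_map] at this
    exact top_le_iff.1 ((Subgroup.map_le_map_iff_of_injective hΦ).1 this)
  have lift : ∀ M ∈ dotIsometry (Fin (m + 1)), ∃ x, Φ x = M := fun M hM => by
    rwa [← hrange] at hM
  obtain ⟨s, hs⟩ := lift _ (permIsometry_mem (finRotate (m + 1)))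
  obtain ⟨z, hz⟩ := lift _ (mixedInvolution_mem p)
  obtain ⟨x, hx⟩ := lift _ (permIsometry_mem Fin.revPerm)
  obtain ⟨y, hy⟩ := lift _ (permIsometry_mem (Fin.revPerm * finRotate (m + 1)))
  have order_two : ∀ g : G, Φ g * Φ g = 1 → Φ g ≠ 1 → orderOf g = 2 := by
    intro g h1 h2
    refine orderOf_eq_prime (hΦ ?_) fun h => h2 (by rw [h, map_one])
    rw [map_pow, sq, h1, map_one]
  refine ⟨⟨s, z, top_of _ ?_ ?_⟩, ⟨x, y, z, order_two x ?_ ?_, order_two y ?_ ?_, order_two z ?_ ?_,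
    top_of _ ?_ ?_⟩⟩
  · exact ⟨s, Subgroup.subset_closure (by simp), hs⟩
  · exact ⟨z, Subgroup.subset_closure (by simp), hz⟩
  · rw [hx, ← map_mul, ← map_one (permIsometry _)]
    congr 1
    ext i
    simp
  · rw [hx, ← map_one (permIsometry _)]
    intro h
    have := DFunLike.congr_fun (permIsometry_injective _ h) 0
    simp [Fin.ext_iff] at this
    omega
  · rw [hy, ← map_mul, revPerm_mul_finRotate_sq, map_one]
  · rw [hy, ← map_one (permIsometry _)]
    intro h
    have := DFunLike.congr_fun (permIsometry_injective _ h) (p 0)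
    rw [Equiv.Perm.mul_apply, hσp, hp_def] at this
    simp only at this
    rw [finRotate_pow_apply_zero m _ (by omega)] at this
    simp [Fin.ext_iff] at this
    omega
  · rw [hz, mixedInvolution_mul_self hp]
  · rw [hz]
    exact mixedInvolution_ne_one hp
  · refine ⟨x * y, mul_mem (Subgroup.subset_closure (by simp)) (Subgroup.subset_closure (by simp)),
      ?_⟩
    rw [map_mul, hx, hy, ← map_mul, ← mul_assoc]
    congr 1
    ext i
    simp
  · exact ⟨z, Subgroup.subset_closure (by simp), hz⟩

/-! ### The symplectic group acting by isometries -/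

theorem symForm_eq_sum {h : ℕ} (v w : Fin h ⊕ Fin h → ZMod 2) :
    v ⬝ᵥ (J (Fin h) (ZMod 2) *ᵥ w) =
      ∑ i, (v (Sum.inl i) * w (Sum.inr i) + v (Sum.inr i) * w (Sum.inl i)) := by
  rw [J, fromBlocks_mulVec, dotProduct, Fintype.sum_sum_type, Finset.sum_add_distrib]
  simp [neg_mulVec, CharTwo.neg_eq]

/-- A linear map preserving the symplectic form is given by a symplectic matrix. -/
theorem exists_symplectic_of_preserves {h : ℕ}
    (f : (Fin h ⊕ Fin h → ZMod 2) →ₗ[ZMod 2] (Fin h ⊕ Fin h → ZMod 2))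
    (hf : ∀ v w, f v ⬝ᵥ (J (Fin h) (ZMod 2) *ᵥ f w) = v ⬝ᵥ (J (Fin h) (ZMod 2) *ᵥ w)) :
    ∃ A : SpTwo h, ∀ v, A.1 *ᵥ v = f v := by
  have hA : ∀ v, LinearMap.toMatrix' f *ᵥ v = f v := fun v => LinearMap.toMatrix'_mulVec f v
  refine ⟨⟨LinearMap.toMatrix' f, SymplecticGroup.mem_iff'.2 ?_⟩, hA⟩
  have entry : ∀ (B : Matrix (Fin h ⊕ Fin h) (Fin h ⊕ Fin h) (ZMod 2)) i j,
      B i j = Pi.single i 1 ⬝ᵥ (B *ᵥ Pi.single j 1) := fun B i j => by simp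
  ext i j
  rw [entry ((LinearMap.toMatrix' f)ᵀ * J (Fin h) (ZMod 2) * LinearMap.toMatrix' f) i j,
    entry (J _ _) i j, ← hf, ← hA, ← hA, ← mulVec_mulVec, ← mulVec_mulVec,
    dotProduct_mulVec, vecMul_transpose]

/-- Vectors `α i`, `β i` of `ℤ₂^ι` forming a symplectic family for the dot product. -/
structure SymplecticFamily (h : ℕ) (ι : Type*) [Fintype ι] where
  α : Fin h → ι → ZMod 2
  β : Fin h → ι → ZMod 2
  dot_αα : ∀ i j, α i ⬝ᵥ α j = 0
  dot_ββ : ∀ i j, β i ⬝ᵥ β j = 0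
  dot_αβ : ∀ i j, α i ⬝ᵥ β j = if i = j then 1 else 0

namespace SymplecticFamily

variable {h : ℕ} {ι : Type*} [Fintype ι] (F : SymplecticFamily h ι)

/-- The isometric embedding of `ℤ₂^{2h}` given by a symplectic family. -/
def emb : (Fin h ⊕ Fin h → ZMod 2) →ₗ[ZMod 2] (ι → ZMod 2) where
  toFun v := ∑ i, (v (Sum.inl i) • F.α i + v (Sum.inr i) • F.β i)
  map_add' v w := by
    rw [← Finset.sum_add_distrib]
    refine Finset.sum_congr rfl fun i _ => ?_
    simp only [Pi.add_apply, add_smul]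
    abel
  map_smul' r v := by
    simp only [Pi.smul_apply, smul_assoc, Finset.smul_sum, smul_add, RingHom.id_apply]

/-- The adjoint of the embedding. -/
def adj : (ι → ZMod 2) →ₗ[ZMod 2] (Fin h ⊕ Fin h → ZMod 2) where
  -- The coordinate along `α i` is read off by pairing with `β i`, and conversely.
  toFun x := Sum.elim (fun i => x ⬝ᵥ F.β i) (fun i => x ⬝ᵥ F.α i)
  map_add' x y := by ext (i | i) <;> simp [add_dotProduct]
  map_smul' r x := by ext (i | i) <;> simp [smul_dotProduct]

theorem dot_emb (x : ι → ZMod 2) (v : Fin h ⊕ Fin h → ZMod 2) :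
    x ⬝ᵥ F.emb v = F.adj x ⬝ᵥ (J (Fin h) (ZMod 2) *ᵥ v) := by
  rw [symForm_eq_sum]
  simp only [emb, adj, LinearMap.coe_mk, AddHom.coe_mk, dotProduct_sum, dotProduct_add,
    dotProduct_smul, smul_eq_mul, Sum.elim_inl, Sum.elim_inr]
  exact Finset.sum_congr rfl fun i _ => by ring

theorem emb_dot (v : Fin h ⊕ Fin h → ZMod 2) (x : ι → ZMod 2) :
    F.emb v ⬝ᵥ x = v ⬝ᵥ (J (Fin h) (ZMod 2) *ᵥ F.adj x) := by
  rw [dotProduct_comm, dot_emb, symForm_eq_sum, symForm_eq_sum]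
  exact Finset.sum_congr rfl fun i _ => by ring

theorem adj_emb (v : Fin h ⊕ Fin h → ZMod 2) : F.adj (F.emb v) = v := by
  have hβα : ∀ i j, F.β i ⬝ᵥ F.α j = if i = j then 1 else 0 := fun i j => by
    rw [dotProduct_comm, F.dot_αβ]; simp only [eq_comm]
  ext (i | i) <;>
    simp [emb, adj, add_dotProduct, smul_dotProduct, F.dot_αα, F.dot_ββ, F.dot_αβ,
      hβα]

theorem emb_dot_emb (v w : Fin h ⊕ Fin h → ZMod 2) :
    F.emb v ⬝ᵥ F.emb w = v ⬝ᵥ (J (Fin h) (ZMod 2) *ᵥ w) := by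
  rw [dot_emb, adj_emb]

theorem adj_eq_zero {x : ι → ZMod 2} (hα : ∀ i, x ⬝ᵥ F.α i = 0) (hβ : ∀ i, x ⬝ᵥ F.β i = 0) :
    F.adj x = 0 := by
  ext (i | i)
  · exact hβ i
  · exact hα i

/-- The vector `x + emb (adj x)` is orthogonal to the image of the embedding. -/
theorem add_emb_adj_dot (x : ι → ZMod 2) (v : Fin h ⊕ Fin h → ZMod 2) :
    (x + F.emb (F.adj x)) ⬝ᵥ F.emb v = 0 := by
  rw [dot_emb, map_add, adj_emb, vec_add_self, zero_dotProduct]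

/-- The linear map which acts as `A` on the image of the embedding, and trivially on its
orthogonal complement. -/
def extMap (A : Matrix (Fin h ⊕ Fin h) (Fin h ⊕ Fin h) (ZMod 2)) :
    (ι → ZMod 2) →ₗ[ZMod 2] (ι → ZMod 2) :=
  LinearMap.id + F.emb ∘ₗ (A.mulVecLin + LinearMap.id) ∘ₗ F.adj

theorem extMap_apply (A : Matrix (Fin h ⊕ Fin h) (Fin h ⊕ Fin h) (ZMod 2)) (x : ι → ZMod 2) :
    F.extMap A x = x + F.emb (A *ᵥ F.adj x + F.adj x) := rfl

theorem adj_extMap (A : Matrix (Fin h ⊕ Fin h) (Fin h ⊕ Fin h) (ZMod 2)) (x : ι → ZMod 2) :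
    F.adj (F.extMap A x) = A *ᵥ F.adj x := by
  rw [extMap_apply, map_add, adj_emb, add_left_comm, vec_add_self, add_zero]

theorem extMap_extMap (A B : Matrix (Fin h ⊕ Fin h) (Fin h ⊕ Fin h) (ZMod 2)) (x : ι → ZMod 2) :
    F.extMap A (F.extMap B x) = F.extMap (A * B) x := by
  rw [extMap_apply, adj_extMap, extMap_apply, extMap_apply, mulVec_mulVec, add_assoc, ← map_add]
  congr 2
  have := vec_add_self (B *ᵥ F.adj x)
  linear_combination this

theorem extMap_one (x : ι → ZMod 2) : F.extMap 1 x = x := by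
  rw [extMap_apply, one_mulVec, vec_add_self, map_zero, add_zero]

/-- The action of the symplectic group on `ℤ₂^ι` obtained from a symplectic family. -/
def ext : SpTwo h →* ((ι → ZMod 2) ≃ₗ[ZMod 2] (ι → ZMod 2)) where
  toFun A :=
    { F.extMap A.1 with
      invFun := F.extMap (A⁻¹).1
      left_inv := fun x => (F.extMap_extMap _ _ x).trans <| by
        rw [show (A⁻¹).1 * A.1 = 1 from congrArg Subtype.val (inv_mul_cancel A), extMap_one]
      right_inv := fun x => (F.extMap_extMap _ _ x).trans <| by
        rw [show A.1 * (A⁻¹).1 = 1 from congrArg Subtype.val (mul_inv_cancel A), extMap_one] }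
  map_one' := LinearEquiv.ext F.extMap_one
  map_mul' A B := LinearEquiv.ext fun x => (F.extMap_extMap A.1 B.1 x).symm

theorem ext_apply (A : SpTwo h) (x : ι → ZMod 2) :
    F.ext A x = x + F.emb (A.1 *ᵥ F.adj x + F.adj x) := rfl

theorem ext_emb (A : SpTwo h) (v : Fin h ⊕ Fin h → ZMod 2) :
    F.ext A (F.emb v) = F.emb (A.1 *ᵥ v) := by
  rw [ext_apply, adj_emb, ← map_add, add_left_comm, vec_add_self, add_zero]

theorem ext_of_adj_eq_zero (A : SpTwo h) {x : ι → ZMod 2} (hx : F.adj x = 0) : F.ext A x = x := by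
  rw [ext_apply, hx, mulVec_zero, add_zero, map_zero, add_zero]

theorem ext_mem (A : SpTwo h) : F.ext A ∈ dotIsometry ι := by
  have key : ∀ x y, F.ext A x ⬝ᵥ F.ext A y = x ⬝ᵥ y := by
    intro x y
    rw [ext_apply, ext_apply, add_dotProduct, dotProduct_add, dotProduct_add, emb_dot_emb, dot_emb,
      emb_dot]
    simp only [mulVec_add, add_dotProduct, dotProduct_add, symplectic_preserves]
    set a := F.adj x ⬝ᵥ (J (Fin h) (ZMod 2) *ᵥ (A.1 *ᵥ F.adj y))
    set b := F.adj x ⬝ᵥ (J (Fin h) (ZMod 2) *ᵥ F.adj y)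
    set c := (A.1 *ᵥ F.adj x) ⬝ᵥ (J (Fin h) (ZMod 2) *ᵥ F.adj y)
    linear_combination CharTwo.add_self_eq_zero a + CharTwo.add_self_eq_zero b +
      CharTwo.add_self_eq_zero b + CharTwo.add_self_eq_zero c
  exact key

theorem ext_injective : Function.Injective F.ext := by
  intro A B hAB
  refine Subtype.ext (Matrix.ext_of_mulVec_single fun i => ?_)
  have := congrArg F.adj (DFunLike.congr_fun hAB (F.emb (Pi.single i 1)))
  rwa [ext_emb, ext_emb, adj_emb, adj_emb] at this

/-- An isometry fixing the orthogonal complement of the image of the embedding comes from a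
symplectic matrix. -/
theorem mem_range_ext {M : (ι → ZMod 2) ≃ₗ[ZMod 2] (ι → ZMod 2)} (hM : M ∈ dotIsometry ι)
    (hfix : ∀ y, (∀ v, y ⬝ᵥ F.emb v = 0) → M y = y) : ∃ A, F.ext A = M := by
  have hcomp : ∀ x, M (x + F.emb (F.adj x)) = x + F.emb (F.adj x) := fun x =>
    hfix _ (F.add_emb_adj_dot x)
  -- `emb ∘ adj` is the self-adjoint projection onto the image, and `M` fixes the complement, so `M
  -- (emb v)` has no component there.
  have hemb : ∀ v, F.emb (F.adj (M (F.emb v))) = M (F.emb v) := by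
    intro v
    have h0 : M (F.emb v) + F.emb (F.adj (M (F.emb v))) = 0 := by
      set y := M (F.emb v) with hy
      refine dotProduct_eq_zero _ fun z => ?_
      have e : (y + F.emb (F.adj y)) ⬝ᵥ z = y ⬝ᵥ (z + F.emb (F.adj z)) := by
        rw [add_dotProduct, dotProduct_add, emb_dot, dot_emb]
      rw [e, ← hcomp z, hy, hM, dotProduct_comm, add_emb_adj_dot]
    have := vec_add_self (F.emb (F.adj (M (F.emb v))))
    linear_combination this - h0
  obtain ⟨A, hA⟩ := exists_symplectic_of_preserves (F.adj ∘ₗ M.toLinearMap ∘ₗ F.emb) <| by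
    intro v w
    rw [← F.emb_dot_emb, ← F.emb_dot_emb]
    simp only [LinearMap.comp_apply, LinearEquiv.coe_coe]
    rw [hemb, hemb, hM]
  refine ⟨A, LinearEquiv.ext fun x => ?_⟩
  have hx := hcomp x
  rw [map_add] at hx
  rw [ext_apply, hA]
  simp only [LinearMap.comp_apply, LinearEquiv.coe_coe]
  rw [map_add, hemb]
  have := vec_add_self (M (F.emb (F.adj x)))
  linear_combination this - hx

end SymplecticFamily

/-! ### Eichler transformations and the semidirect product -/

/-- The vector `1` represents the linear form `x ↦ x ⬝ x`, which isometries preserve. -/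
theorem dotIsometry_fix_one {ι : Type*} [Fintype ι] {M : (ι → ZMod 2) ≃ₗ[ZMod 2] (ι → ZMod 2)}
    (hM : M ∈ dotIsometry ι) : M 1 = 1 := by
  have hone : ∀ x : ι → ZMod 2, x ⬝ᵥ 1 = x ⬝ᵥ x := fun x =>
    Finset.sum_congr rfl fun i _ => by rw [zmod_two_mul_self, Pi.one_apply, mul_one]
  refine dotProduct_eq _ _ fun y => ?_
  obtain ⟨x, rfl⟩ := M.surjective y
  rw [hM, dotProduct_comm 1 x, hone, dotProduct_comm 1 (M x), hone, hM]

theorem dotIsometry_dot_one {ι : Type*} [Fintype ι] {M : (ι → ZMod 2) ≃ₗ[ZMod 2] (ι → ZMod 2)}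
    (hM : M ∈ dotIsometry ι) (x : ι → ZMod 2) : M x ⬝ᵥ 1 = x ⬝ᵥ 1 := by
  conv_lhs => rw [← dotIsometry_fix_one hM]
  exact hM x 1

namespace SymplecticFamily

section eichler

variable {h : ℕ} {ι : Type*} [Fintype ι] (F : SymplecticFamily h ι)

/-- The Eichler transformation of `ℤ₂^ι` attached to an element of `ℤ₂^{2h+1}`. -/
def eichlerMap (x : ElemAb h) : (ι → ZMod 2) →ₗ[ZMod 2] (ι → ZMod 2) where
  toFun y := y + (y ⬝ᵥ F.emb x.1) • (1 : ι → ZMod 2) +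
    (y ⬝ᵥ 1) • (F.emb x.1 + (x.2 + stdQuad h x.1) • (1 : ι → ZMod 2))
  map_add' y z := by
    simp only [add_dotProduct, add_smul]
    abel
  map_smul' r y := by
    simp only [smul_dotProduct, smul_add, smul_assoc, RingHom.id_apply]

theorem eichlerMap_apply (x : ElemAb h) (y : ι → ZMod 2) :
    F.eichlerMap x y = y + (y ⬝ᵥ F.emb x.1) • (1 : ι → ZMod 2) +
      (y ⬝ᵥ 1) • (F.emb x.1 + (x.2 + stdQuad h x.1) • (1 : ι → ZMod 2)) := rfl

theorem eichlerMap_zero (y : ι → ZMod 2) : F.eichlerMap 0 y = y := by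
  rw [eichlerMap_apply]
  simp [stdQuad]

variable (h_one : (1 : ι → ZMod 2) ⬝ᵥ 1 = 0) (h_adj : F.adj 1 = 0)

include h_adj in
theorem emb_dot_one (v : Fin h ⊕ Fin h → ZMod 2) : F.emb v ⬝ᵥ 1 = 0 := by
  rw [emb_dot, h_adj, mulVec_zero, dotProduct_zero]

include h_one h_adj in
theorem eichlerMap_dot_one (x : ElemAb h) (y : ι → ZMod 2) :
    F.eichlerMap x y ⬝ᵥ 1 = y ⬝ᵥ 1 := by
  simp only [eichlerMap_apply, add_dotProduct, smul_dotProduct, h_one, F.emb_dot_one h_adj,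
    smul_zero, add_zero]

include h_adj in
theorem eichlerMap_dot_emb (x : ElemAb h) (y : ι → ZMod 2) (v : Fin h ⊕ Fin h → ZMod 2) :
    F.eichlerMap x y ⬝ᵥ F.emb v =
      y ⬝ᵥ F.emb v + (y ⬝ᵥ 1) * (v ⬝ᵥ (J (Fin h) (ZMod 2) *ᵥ x.1)) := by
  have h1 : (1 : ι → ZMod 2) ⬝ᵥ F.emb v = 0 := by
    rw [dotProduct_comm, F.emb_dot_one h_adj]
  simp only [eichlerMap_apply, add_dotProduct, smul_dotProduct, h1, add_zero,
    dotProduct_comm (F.emb x.1), emb_dot_emb, smul_eq_mul, mul_zero]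

include h_one h_adj in
-- Composition creates the extra term `emb v ⬝ emb v'`, the polarization of `q`; the summand
-- `stdQuad` in the coefficient of `1` absorbs it.
theorem eichlerMap_eichlerMap (x x' : ElemAb h) (y : ι → ZMod 2) :
    F.eichlerMap x (F.eichlerMap x' y) = F.eichlerMap (x + x') y := by
  rw [eichlerMap_apply, F.eichlerMap_dot_one h_one h_adj, F.eichlerMap_dot_emb h_adj,
    eichlerMap_apply, eichlerMap_apply, Prod.fst_add, Prod.snd_add, stdQuad_add, map_add,
    dotProduct_add]
  ext i
  simp only [Pi.add_apply, Pi.smul_apply, Pi.one_apply, smul_eq_mul]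
  ring

include h_one h_adj in
theorem eichlerMap_involutive (x : ElemAb h) : Function.Involutive (F.eichlerMap x) := fun y => by
  have hx : x + x = 0 := Prod.ext (vec_add_self _) (CharTwo.add_self_eq_zero _)
  rw [F.eichlerMap_eichlerMap h_one h_adj, hx, eichlerMap_zero]

/-- The Eichler transformations form a representation of `ℤ₂^{2h+1}`. -/
def eichler : Multiplicative (ElemAb h) →* ((ι → ZMod 2) ≃ₗ[ZMod 2] (ι → ZMod 2)) where
  toFun x := LinearEquiv.ofInvolutive (F.eichlerMap x.toAdd)
    (F.eichlerMap_involutive h_one h_adj x.toAdd)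
  map_one' := by
    ext1 y
    exact F.eichlerMap_zero y
  map_mul' x x' := by
    ext1 y
    exact (F.eichlerMap_eichlerMap h_one h_adj x.toAdd x'.toAdd y).symm

theorem eichler_mem (x : Multiplicative (ElemAb h)) :
    F.eichler h_one h_adj x ∈ dotIsometry ι := by
  intro y z
  change F.eichlerMap x.toAdd y ⬝ᵥ F.eichlerMap x.toAdd z = y ⬝ᵥ z
  obtain ⟨v, t⟩ := x.toAdd
  have hv : v ⬝ᵥ (J (Fin h) (ZMod 2) *ᵥ v) = 0 := by
    rw [symForm_eq_sum]
    exact Finset.sum_eq_zero fun i _ => by rw [mul_comm]; exact CharTwo.add_self_eq_zero _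
  conv_lhs => rw [F.eichlerMap_apply _ z]
  rw [dotProduct_add, dotProduct_add, dotProduct_smul, dotProduct_smul, dotProduct_add,
    dotProduct_smul, F.eichlerMap_dot_one h_one h_adj, F.eichlerMap_dot_emb h_adj, hv,
    eichlerMap_apply]
  simp only [add_dotProduct, smul_dotProduct, smul_eq_mul, dotProduct_comm 1 z,
    dotProduct_comm (F.emb v) z]
  linear_combination CharTwo.add_self_eq_zero ((y ⬝ᵥ F.emb v) * (z ⬝ᵥ 1)) +
    CharTwo.add_self_eq_zero ((y ⬝ᵥ 1) * (z ⬝ᵥ F.emb v)) +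
    CharTwo.add_self_eq_zero ((y ⬝ᵥ 1) * (z ⬝ᵥ 1) * (t + stdQuad h v))

include h_adj in
-- Conjugation turns `v` into `A v` but keeps the coefficient `t + q(v)`; this forces `t ↦ t + q(A
-- v) + q(v)`, the given action.
theorem ext_eichlerMap (A : SpTwo h) (x : ElemAb h) (y : ι → ZMod 2) :
    F.ext A (F.eichlerMap x y) = F.eichlerMap (spActEquiv h A x) (F.ext A y) := by
  have h1 : F.ext A 1 = 1 := F.ext_of_adj_eq_zero A h_adj
  have h2 : F.ext A y ⬝ᵥ 1 = y ⬝ᵥ 1 := dotIsometry_dot_one (F.ext_mem A) y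
  have h3 : F.ext A y ⬝ᵥ F.emb (A.1 *ᵥ x.1) = y ⬝ᵥ F.emb x.1 := by
    rw [← ext_emb]; exact F.ext_mem A _ _
  rw [eichlerMap_apply, eichlerMap_apply]
  simp only [map_add, map_smul, h1, ext_emb, spActEquiv, AddEquiv.coe_mk, Equiv.coe_fn_mk, h2, h3]
  congr 4
  linear_combination -CharTwo.add_self_eq_zero (stdQuad h (A.1 *ᵥ x.1))

/-- The action of `Sp(2h; ℤ₂) ⋉ ℤ₂^{2h+1}` on `ℤ₂^ι` by isometries. -/
def semidirectExt : SpSemidirect h →* ((ι → ZMod 2) ≃ₗ[ZMod 2] (ι → ZMod 2)) :=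
  SemidirectProduct.lift (F.eichler h_one h_adj) F.ext fun A => by
    refine MonoidHom.ext fun x => LinearEquiv.ext fun y => ?_
    change F.eichlerMap (spActEquiv h A x.toAdd) y =
      F.ext A (F.eichlerMap x.toAdd ((F.ext A)⁻¹ y))
    rw [F.ext_eichlerMap h_adj]
    exact congrArg _ ((F.ext A).apply_symm_apply y).symm

theorem semidirectExt_apply (g : SpSemidirect h) (y : ι → ZMod 2) :
    F.semidirectExt h_one h_adj g y = F.eichlerMap g.left.toAdd (F.ext g.right y) := rfl

variable [DecidableEq ι] (ℓ : ι) (h_last : ∀ v, F.emb v ℓ = 0)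

include h_last in
theorem adj_single : F.adj (Pi.single ℓ 1) = 0 := by
  have := fun v => (F.dot_emb (Pi.single ℓ 1) v).symm
  simp only [single_one_dotProduct, h_last] at this
  refine (dotProduct_eq_zero _ fun w => ?_)
  have hw := this (J (Fin h) (ZMod 2) *ᵥ w)
  rwa [mulVec_mulVec, J_squared, neg_mulVec, one_mulVec, dotProduct_neg, CharTwo.neg_eq] at hw

include h_last in
-- The image of `e_ℓ` determines `(v, t)`, as `emb v` vanishes at `ℓ`. Both injectivity and
-- surjectivity rest on this.
theorem eichlerMap_single (x : ElemAb h) :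
    F.eichlerMap x (Pi.single ℓ 1) =
      Pi.single ℓ 1 + (F.emb x.1 + (x.2 + stdQuad h x.1) • (1 : ι → ZMod 2)) := by
  rw [eichlerMap_apply]
  simp [h_last]

include h_last in
theorem semidirectExt_injective : Function.Injective (F.semidirectExt h_one h_adj) := by
  rw [injective_iff_map_eq_one]
  rintro ⟨x, A⟩ hg
  obtain ⟨v, t⟩ := x
  have hℓ : F.emb v + (t + stdQuad h v) • (1 : ι → ZMod 2) = 0 := by
    have := DFunLike.congr_fun hg (Pi.single ℓ 1)
    rw [semidirectExt_apply, F.ext_of_adj_eq_zero A (F.adj_single ℓ h_last)] at this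
    exact add_eq_left.1 ((F.eichlerMap_single ℓ h_last (v, t)).symm.trans this)
  have hs : t + stdQuad h v = 0 := by
    have := congrFun hℓ ℓ
    simpa [h_last] using this
  rw [hs, zero_smul, add_zero] at hℓ
  have hv : v = 0 := by rw [← F.adj_emb v, hℓ, map_zero]
  subst hv
  have ht : t = 0 := by simpa [stdQuad] using hs
  subst ht
  have hA : F.ext A = 1 := by
    refine LinearEquiv.ext fun y => ?_
    have := DFunLike.congr_fun hg y
    exact (F.eichlerMap_zero _).symm.trans this
  rw [← map_one F.ext] at hA
  exact SemidirectProduct.ext rfl (F.ext_injective hA)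

include h_last in
-- An Eichler map `E` takes `e_ℓ` where `M` does; then `E⁻¹ M` fixes `e_ℓ` and `1`, hence the whole
-- complement, and is symplectic.
theorem semidirectExt_range
    (h_compl : ∀ y : ι → ZMod 2, (∀ v, y ⬝ᵥ F.emb v = 0) →
      ∃ r s : ZMod 2, y = r • (1 : ι → ZMod 2) + s • Pi.single ℓ 1) :
    (F.semidirectExt h_one h_adj).range = dotIsometry ι := by
  apply le_antisymm
  · rintro _ ⟨g, rfl⟩
    exact mul_mem (F.eichler_mem h_one h_adj g.left) (F.ext_mem g.right)
  intro M hM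
  have hsd : (Pi.single ℓ 1 : ι → ZMod 2) ⬝ᵥ 1 = 1 := by simp
  set u' : ι → ZMod 2 := M (Pi.single ℓ 1) + Pi.single ℓ 1 with hu'
  set u := u' + u' ℓ • (1 : ι → ZMod 2) with hu
  have hu'1 : u' ⬝ᵥ 1 = 0 := by
    rw [hu', add_dotProduct, dotIsometry_dot_one hM]
    exact CharTwo.add_self_eq_zero _
  have hu1 : u ⬝ᵥ 1 = 0 := by
    rw [hu, add_dotProduct, smul_dotProduct, h_one, hu'1, smul_zero, add_zero]
  have huℓ : u ℓ = 0 := by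
    simpa [hu] using CharTwo.add_self_eq_zero (u' ℓ)
  -- The component of `u` in the complement is `r 1 + s e_ℓ`; pairing with `1` gives `s = 0`, the
  -- coordinate `ℓ` then `r = 0`.
  have huc : F.emb (F.adj u) = u := by
    obtain ⟨r, s, hrs⟩ := h_compl _ (F.add_emb_adj_dot u)
    have e1 := congrArg (· ⬝ᵥ (1 : ι → ZMod 2)) hrs
    simp only [add_dotProduct, smul_dotProduct, h_one, hsd, hu1, F.emb_dot_one h_adj, add_zero,
      smul_eq_mul, mul_one, mul_zero, zero_add] at e1
    have e2 := congrFun hrs ℓ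
    simp only [Pi.add_apply, Pi.smul_apply, huℓ, h_last, add_zero, Pi.one_apply, smul_eq_mul,
      mul_one, Pi.single_eq_same] at e2
    rw [← e1, add_zero] at e2
    rw [← e1, ← e2, zero_smul, zero_smul, add_zero] at hrs
    have := vec_add_self (F.emb (F.adj u))
    linear_combination this - hrs
  -- The `stdQuad` term cancels the one built into `eichlerMap`, leaving the coefficient `u' ℓ`.
  set x : ElemAb h := (F.adj u, u' ℓ + stdQuad h (F.adj u)) with hx
  have hxM : F.eichlerMap x (Pi.single ℓ 1) = M (Pi.single ℓ 1) := by
    rw [F.eichlerMap_single ℓ h_last, hx]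
    simp only
    rw [huc, add_assoc (u' ℓ), CharTwo.add_self_eq_zero, add_zero, hu, add_assoc u',
      vec_add_self, add_zero, hu', add_left_comm, vec_add_self, add_zero]
  set E := F.eichler h_one h_adj (Multiplicative.ofAdd x) with hE
  have hEM : E⁻¹ * M ∈ dotIsometry ι := mul_mem (inv_mem (F.eichler_mem h_one h_adj _)) hM
  obtain ⟨A, hA⟩ := F.mem_range_ext hEM fun y hy => by
    obtain ⟨r, s, rfl⟩ := h_compl y hy
    have hfix : (E⁻¹ * M) (Pi.single ℓ 1) = Pi.single ℓ 1 := by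
      change E.symm (M (Pi.single ℓ 1)) = _
      rw [LinearEquiv.symm_apply_eq, ← hxM]
      rfl
    rw [map_add, map_smul, map_smul, hfix, dotIsometry_fix_one hEM]
  refine ⟨⟨Multiplicative.ofAdd x, A⟩, ?_⟩
  change E * F.ext A = M
  rw [hA, mul_inv_cancel_left]

end eichler

/-! ### The standard symplectic family -/

/-- The indicator vector of the coordinates `2k+1, …, 2h`. -/
def tailVec (h n k : ℕ) : Fin n → ZMod 2 := fun p => if 2 * k + 1 ≤ p.1 ∧ p.1 ≤ 2 * h then 1 else 0

/-- Tails are nested and have even size `2(h - k)`. -/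
theorem tailVec_dot_tailVec {h n : ℕ} (hn : 2 * h + 1 ≤ n) (i j : ℕ) (hi : i < h) (hj : j < h) :
    tailVec h n i ⬝ᵥ tailVec h n j = 0 := by
  have h1 : tailVec h n i ⬝ᵥ tailVec h n j =
      ((Finset.Icc (⟨2 * max i j + 1, by omega⟩ : Fin n) ⟨2 * h, by omega⟩).card : ZMod 2) := by
    rw [← Finset.filter_univ_mem (Finset.Icc _ _), Finset.card_filter, Nat.cast_sum]
    refine Finset.sum_congr rfl fun p _ => ?_
    simp only [tailVec, Finset.mem_Icc, Fin.le_def, ← ite_and, mul_ite, mul_one, mul_zero,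
      Nat.cast_ite, Nat.cast_one, Nat.cast_zero]
    refine if_congr ?_ rfl rfl
    omega
  rw [h1, Fin.card_Icc]
  refine (ZMod.natCast_eq_zero_iff_even).2 ⟨h - max i j, ?_⟩
  simp only
  omega

/-- The vector with ones in the coordinates `2k` and `2k+1`. -/
def pairVec {h n : ℕ} (hn : 2 * h + 1 ≤ n) (k : Fin h) : Fin n → ZMod 2 :=
  Pi.single ⟨2 * k.1, by omega⟩ 1 + Pi.single ⟨2 * k.1 + 1, by omega⟩ 1

theorem dot_pairVec {h n : ℕ} (hn : 2 * h + 1 ≤ n) (k : Fin h) (x : Fin n → ZMod 2) :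
    x ⬝ᵥ pairVec hn k = x ⟨2 * k.1, by omega⟩ + x ⟨2 * k.1 + 1, by omega⟩ := by
  simp [pairVec, dotProduct_add]

/-- The standard symplectic family in `ℤ₂^n`, spanning the vectors of even weight supported in
the first `2h + 1` coordinates. -/
def std {h n : ℕ} (hn : 2 * h + 1 ≤ n) : SymplecticFamily h (Fin n) where
  α i := tailVec h n i.1
  β i := pairVec hn i
  dot_αα i j := tailVec_dot_tailVec hn i j i.2 j.2
  dot_ββ i j := by
    rw [dot_pairVec]
    simp only [pairVec, Pi.add_apply, Pi.single_apply, Fin.mk.injEq]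
    rcases eq_or_ne i j with rfl | hij
    · simp; decide
    · have := Fin.val_ne_of_ne hij
      rw [if_neg (by omega), if_neg (by omega), if_neg (by omega), if_neg (by omega)]
      rfl
  -- The pair `{2j, 2j+1}` lies inside the tail for `j > i`, outside for `j < i`, and straddles its
  -- start for `j = i`.
  dot_αβ i j := by
    rw [dot_pairVec]
    simp only [tailVec, Fin.ext_iff]
    split_ifs <;> first | omega | decide

section std

variable {h n : ℕ} (hn : 2 * h + 1 ≤ n)

theorem std_emb_apply (v : Fin h ⊕ Fin h → ZMod 2) (p : Fin n) (hp : 2 * h < p.1) :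
    (std hn).emb v p = 0 := by
  simp only [emb, std, LinearMap.coe_mk, AddHom.coe_mk, Finset.sum_apply]
  refine Finset.sum_eq_zero fun i _ => ?_
  simp only [tailVec, pairVec, Pi.add_apply, Pi.smul_apply, Pi.single_apply, Fin.ext_iff]
  rw [if_neg (by omega), if_neg (by omega), if_neg (by omega)]
  simp

theorem std_adj_one : (std hn).adj 1 = 0 := by
  refine adj_eq_zero _ (fun i => ?_) fun i => ?_
  · rw [dotProduct_comm, ← tailVec_dot_tailVec hn i i i.2 i.2]
    exact Finset.sum_congr rfl fun p _ => by rw [zmod_two_mul_self, Pi.one_apply, mul_one]; rfl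
  · change 1 ⬝ᵥ pairVec hn i = 0
    rw [dot_pairVec]
    rfl

theorem emb_single_inl {ι : Type*} [Fintype ι] (F : SymplecticFamily h ι) (i : Fin h) :
    F.emb (Pi.single (Sum.inl i) 1) = F.α i := by
  simp [emb, Pi.single_apply]

theorem emb_single_inr {ι : Type*} [Fintype ι] (F : SymplecticFamily h ι) (i : Fin h) :
    F.emb (Pi.single (Sum.inr i) 1) = F.β i := by
  simp [emb, Pi.single_apply]

/-- A vector orthogonal to the standard symplectic family is constant on the first `2h + 1`
coordinates. -/
theorem std_orthogonal {y : Fin n → ZMod 2} (hy : ∀ v, y ⬝ᵥ (std hn).emb v = 0) :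
    ∀ (p : ℕ) (hp : p < 2 * h + 1), y ⟨p, by omega⟩ = y ⟨0, by omega⟩ := by
  have hβ : ∀ k (hk : k < h), y ⟨2 * k, by omega⟩ = y ⟨2 * k + 1, by omega⟩ := by
    intro k hk
    have := hy (Pi.single (Sum.inr ⟨k, hk⟩) 1)
    rw [emb_single_inr] at this
    exact CharTwo.add_eq_zero.1 ((dot_pairVec hn ⟨k, hk⟩ y).symm.trans this)
  -- The empty tail `k = h` is included so that differences of successive tails reach the last pair
  -- `{2h-1, 2h}`.
  have hα0 : ∀ k, k ≤ h → y ⬝ᵥ tailVec h n k = 0 := by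
    intro k hk
    rcases hk.lt_or_eq with hk | rfl
    · have := hy (Pi.single (Sum.inl ⟨k, hk⟩) 1)
      rwa [emb_single_inl] at this
    · have : tailVec k n k = 0 := by
        ext p
        simp only [tailVec, Pi.zero_apply]
        rw [if_neg (by omega)]
      rw [this, dotProduct_zero]
  have hα : ∀ k (hk : k < h), y ⟨2 * k + 1, by omega⟩ = y ⟨2 * k + 2, by omega⟩ := by
    intro k hk
    have hsum : tailVec h n k = tailVec h n (k + 1) +
        (Pi.single ⟨2 * k + 1, by omega⟩ 1 + Pi.single ⟨2 * k + 2, by omega⟩ 1) := by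
      ext p
      simp only [tailVec, Pi.add_apply, Pi.single_apply, Fin.ext_iff]
      split_ifs <;> first | omega | decide
    have := hα0 k hk.le
    rw [hsum, dotProduct_add, hα0 (k + 1) hk, zero_add, dotProduct_add, dotProduct_single_one,
      dotProduct_single_one] at this
    exact CharTwo.add_eq_zero.1 this
  intro p hp
  induction p with
  | zero => rfl
  | succ p ih =>
    rw [← ih (by omega)]
    rcases Nat.even_or_odd' p with ⟨k, rfl | rfl⟩
    · exact (hβ k (by omega)).symm
    · exact (hα k (by omega)).symm

end std

end SymplecticFamily

/-! ### Conclusion for the two families -/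

/-- With `n = 2h + 1` the complement of the symplectic family is the line through `1`, which every
isometry fixes; `h ≥ 6` means `n ≥ 13`. -/
theorem SpTwo_generated {h : ℕ} (hh : 6 ≤ h) :
    GeneratedByTwoElements (SpTwo h) ∧ GeneratedByThreeInvolutions (SpTwo h) := by
  set F := SymplecticFamily.std (le_refl (2 * h + 1)) with hF
  refine generated_of_range_eq_dotIsometry (by omega) F.ext F.ext_injective (le_antisymm ?_ ?_)
  · rintro _ ⟨A, rfl⟩
    exact F.ext_mem A
  · refine fun M hM => F.mem_range_ext hM fun y hy => ?_
    have : y = y 0 • (1 : Fin (2 * h + 1) → ZMod 2) := by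
      ext p
      simpa using SymplecticFamily.std_orthogonal _ hy p.1 p.2
    rw [this, map_smul, dotIsometry_fix_one hM]

/-- With `n = 2h + 2` the complement is spanned by `1` and the last basis vector. -/
theorem SpSemidirect_generated {h : ℕ} (hh : 6 ≤ h) :
    GeneratedByTwoElements (SpSemidirect h) ∧ GeneratedByThreeInvolutions (SpSemidirect h) := by
  have hn : 2 * h + 1 ≤ 2 * h + 2 := by omega
  set F := SymplecticFamily.std hn with hF
  have h_one : (1 : Fin (2 * h + 2) → ZMod 2) ⬝ᵥ 1 = 0 := by
    rw [one_dotProduct_one, Fintype.card_fin]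
    exact ZMod.natCast_eq_zero_iff_even.2 ⟨h + 1, by ring⟩
  have h_last : ∀ v, F.emb v (Fin.last _) = 0 := fun v =>
    SymplecticFamily.std_emb_apply hn v _ (by simp)
  have h_adj := SymplecticFamily.std_adj_one hn
  refine generated_of_range_eq_dotIsometry (by omega) (F.semidirectExt h_one h_adj)
    (F.semidirectExt_injective h_one h_adj _ h_last)
    (F.semidirectExt_range h_one h_adj _ h_last fun y hy => ⟨y 0, y 0 + y (Fin.last _), ?_⟩)
  ext p
  rcases eq_or_ne p (Fin.last _) with rfl | hp
  · simp only [Pi.add_apply, Pi.smul_apply, Pi.one_apply, Pi.single_eq_same, smul_eq_mul, mul_one]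
    linear_combination -CharTwo.add_self_eq_zero (y 0)
  · have hlt : p.1 < 2 * h + 1 := Fin.val_lt_last hp
    simpa [hp] using SymplecticFamily.std_orthogonal hn hy p.1 hlt

theorem corollaryC :
    (∀ g : ℕ, Odd g → 19 ≤ g → GeneratedByTwoElements (SpTwo ((g - 1) / 2))) ∧
    (∀ g : ℕ, Odd g → 27 ≤ g → GeneratedByThreeInvolutions (SpTwo ((g - 1) / 2))) ∧
    (∀ g : ℕ, Even g → 20 ≤ g → GeneratedByTwoElements (SpSemidirect ((g - 2) / 2))) ∧
    (∀ g : ℕ, Even g → 26 ≤ g → GeneratedByThreeInvolutions (SpSemidirect ((g - 2) / 2))) :=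
  ⟨fun _ _ _ => (SpTwo_generated (by omega)).1, fun _ _ _ => (SpTwo_generated (by omega)).2,
    fun _ _ _ => (SpSemidirect_generated (by omega)).1,
    fun _ _ _ => (SpSemidirect_generated (by omega)).2⟩
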